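/- Let $\Omega=\{0,1\}^{\mathbb N}$ be the Cantor space, let $\mathbb B^*$ be the set of finite binary strings, and for $x\in\mathbb B^*$ let $[x]\subseteq\Omega$ be the set of infinite extensions of $x$; $\log$ is the binary logarithm, with $\log 0=-\infty$ and $\log\infty=\infty$. Let $\mu$ be a computable measure on $\Omega$, i.e. a finite Borel measure for which some algorithm computes, from a string $x$ and a rational $\varepsilon>0$, a rational $\varepsilon$-approximation of $\mu([x])$. A function $t:\Omega\to[0,\infty]$ is lower semicomputable if some machine, given a rational $r$, enumerates a set of intervals whose union is $\{\omega:t(\omega)>r\}$; it is probability bounded (with respect to $\mu$) if $\mu\{\omega:t(\omega)>c\}\le 1/c$ for every rational $c>0$. Let $\mathbf t_\mu^P$ be a largest, up to a multiplicative constant, lower semicomputable probability bounded function, and let $\mathbf d_\mu^P=\log\mathbf t_\mu^P$ (the Martin-Löf deficiency). A continuous lower semicomputable semimeasure is a function $a:\mathbb B^*\to[0,\infty)$ which is the pointwise limit of an increasing computable sequence of finitely supported rational-valued functions and satisfies $\sum_{x\in S}a(x)\le1$ for every prefix-free set $S\subseteq\mathbb B^*$. Let $\mathbf a$ be a largest,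 up to a multiplicative constant, continuous lower semicomputable semimeasure, let $KA(x)=-\log\mathbf a(x)$, and let $$\mathbf d^A_\mu(\omega)=\sup_n\{-\log\mu([\omega_{1\ldots n}])-KA(\omega_{1\ldots n})\}$$ (the a priori deficiency). Then such $\mathbf a$ and $\mathbf t^P_\mu$ exist, and for every choice of them there is a constant $c\in\mathbb R$ such that, for all $\omega\in\Omega$, $$\mathbf d^A_\mu(\omega)\le\mathbf d^P_\mu(\omega)+c .$$ -/

import Mathlib

open MeasureTheory Filter Topology
open scoped NNReal ENNReal

noncomputable section

namespace RandDef

/-- The Cantor space of infinite binary sequences, with the product topology and its Borel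
`σ`-algebra (the product `σ`-algebra). -/
abbrev Cantor : Type := ℕ → Bool

/-- Finite binary strings. -/
abbrev Str : Type := List Bool

/-- The initial segment of length `n` of a sequence. -/
def initSeg (ω : Cantor) (n : ℕ) : Str := List.ofFn fun i : Fin n => ω i

/-- The interval `[x]`: all infinite extensions of the string `x`. -/
def cyl (x : Str) : Set Cantor := {ω | initSeg ω x.length = x}

/-- Nonnegative rationals as constructive objects: the pair `(m, n)` stands for `m / (n + 1)`.
Every nonnegative rational is of this form. -/
def rat (p : ℕ × ℕ) : ℝ≥0 := (p.1 : ℝ≥0) / ((p.2 : ℝ≥0) + 1)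

/-- A measure on the Cantor space is computable if some algorithm computes from a string `x` and
a rational `ε > 0` a rational `ε`-approximation of `μ [x]`. -/
def IsComputableMeasure (μ : Measure Cantor) : Prop :=
  ∃ f : Str → ℕ × ℕ → ℕ × ℕ, Computable₂ f ∧
    ∀ (x : Str) (ε : ℕ × ℕ), 0 < rat ε →
      |(rat (f x ε) : ℝ) - (μ (cyl x)).toReal| ≤ (rat ε : ℝ)

/-- A function `t : Cantor → [0, ∞]` is lower semicomputable if, uniformly in the rational `r`,
one can enumerate a set of intervals with union `{ω | r < t ω}`.
(For negative `r` this set is the whole space, so nonnegative `r` suffice.) -/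
def LowerSemicomputable (t : Cantor → ℝ≥0∞) : Prop :=
  ∃ W : (ℕ × ℕ) × Str → Prop, REPred W ∧
    ∀ r : ℕ × ℕ, {ω | (rat r : ℝ≥0∞) < t ω} = ⋃ x ∈ {x : Str | W (r, x)}, cyl x

/-- `t` is probability bounded: `μ {t > c} ≤ 1 / c` for all rational `c > 0`. -/
def ProbBounded (μ : Measure Cantor) (t : Cantor → ℝ≥0∞) : Prop :=
  ∀ c : ℕ × ℕ, 0 < rat c → μ {ω | (rat c : ℝ≥0∞) < t ω} ≤ 1 / (rat c : ℝ≥0∞)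

/-- `t` is a largest (up to a multiplicative constant) lower semicomputable probability bounded
function with respect to `μ`. -/
def IsMaxProbBounded (μ : Measure Cantor) (t : Cantor → ℝ≥0∞) : Prop :=
  (LowerSemicomputable t ∧ ProbBounded μ t) ∧
    ∀ t' : Cantor → ℝ≥0∞, LowerSemicomputable t' → ProbBounded μ t' →
      ∃ C : ℝ≥0, ∀ ω, t' ω ≤ C * t ω

/-- The basic (finitely supported, rational valued) function on strings given by a finite list of
pairs `(x, q)`, namely the sum of the functions `q · 𝟙_{x}`. -/
def basic (L : List (Str × (ℕ × ℕ))) (x : Str) : ℝ≥0 :=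
  (L.map fun p => if p.1 = x then rat p.2 else 0).sum

/-- A function `a : Str → [0, ∞)` is lower semicomputable if it is the pointwise limit of an
increasing computable sequence of basic functions. -/
def LowerSemicomputableStr (a : Str → ℝ≥0) : Prop :=
  ∃ f : ℕ → List (Str × (ℕ × ℕ)), Computable f ∧ Monotone (fun n => basic (f n)) ∧
    ∀ x, Tendsto (fun n => basic (f n) x) atTop (𝓝 (a x))

/-- No element of `S` is a proper prefix of another element of `S`. -/
def PrefixFree (S : Set Str) : Prop := ∀ x ∈ S, ∀ y ∈ S, x <+: y → x = y

/-- Continuous lower semicomputable semimeasures. -/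
def IsContSemimeasure (a : Str → ℝ≥0) : Prop :=
  LowerSemicomputableStr a ∧
    ∀ S : Set Str, PrefixFree S → ∑' x : S, (a (x : Str) : ℝ≥0∞) ≤ 1

/-- `a` is a continuous a priori probability: a largest (up to a multiplicative constant)
continuous lower semicomputable semimeasure. -/
def IsAPriori (a : Str → ℝ≥0) : Prop :=
  IsContSemimeasure a ∧
    ∀ a' : Str → ℝ≥0, IsContSemimeasure a' → ∃ C : ℝ≥0, ∀ x, a' x ≤ C * a x

/-- The binary logarithm `[0, ∞] → [-∞, ∞]`. -/
def log2 (x : ℝ≥0∞) : EReal := ENNReal.log x / ((Real.log 2 : ℝ) : EReal)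

/-- A priori complexity `KA x = - log a(x)`. -/
def KA (a : Str → ℝ≥0) (x : Str) : EReal := - log2 (a x)

/-- A priori randomness deficiency `sup_n {- log μ [ω_{1…n}] - KA (ω_{1…n})}`. -/
def dA (μ : Measure Cantor) (a : Str → ℝ≥0) (ω : Cantor) : EReal :=
  ⨆ n : ℕ, (- log2 (μ (cyl (initSeg ω n))) - KA a (initSeg ω n))

/-- Probability bounded deficiency `log t(ω)`. -/
def dP (t : Cantor → ℝ≥0∞) (ω : Cantor) : EReal := log2 (t ω)

end RandDef

end

/-! Let `maxRatio` be the supremum of `a(x) / μ[x]` over the prefixes `x` of `ω`; its logarithm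
bounds the a priori deficiency. The set where it exceeds `r` is the union of the intervals `[x]`
with `a(x) > r μ[x]`. Keeping only the minimal such `x` leaves the union unchanged and makes the
intervals disjoint, so its measure is at most `(1/r) ∑ a(x) ≤ 1/r`, the sum being over a prefix-free
set. Since `a` is approximable from below and `μ` from above, `maxRatio` is lower semicomputable;
the maximal `t` therefore dominates it up to a factor, which becomes the additive constant
(`probBounded_maxRatio`, `rePred_lt_ratio`).

Both maximal objects are built by listing all programs, trimming each one so that it obeys the
required bound, and combining them with weights `2^{-(encode c + 1)}`.

For `a`, a program enumerates rational lower bounds. A stage is accepted if its finite approximation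
satisfies the semimeasure inequality, which is decidable. A program for a true semimeasure passes at
every stage.

For `t`, a program enumerates strings at level `k`, and a stage is accepted if its intervals have
total measure below `2 / 2^k`. This is only semidecidable, as `μ` is known approximately; a
legitimate program has measure at most `1 / 2^k`, and the spare factor 2 makes the strict inequality
hold. The trimmed sets form a universal Martin-Löf test, from which `t` is read off as the supremum
of `2^m` over the levels `m` containing `ω`, with a positive floor. -/

noncomputable section

namespace RandDef

open Nat.Partrec (Code)
open Nat.Partrec.Code Encodable

/-! ### Enumerable predicates and their finite stages -/

section Enumerability

variable {α β : Type*} [Primcodable α] [Primcodable β]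

theorem primrecRel_evaln_isSome (c : Code) :
    PrimrecRel fun (a : α) (k : ℕ) => (evaln k c (encode a)).isSome = true :=
  Primrec.eq.comp
    (Primrec.option_isSome.comp (primrec_evaln.comp
      ((Primrec.snd.pair (Primrec.const c)).pair (Primrec.encode.comp Primrec.fst))))
    (Primrec.const true)

theorem evaln_isSome_mono {c : Code} {n k l : ℕ} (h : k ≤ l)
    (hk : (evaln k c n).isSome = true) : (evaln l c n).isSome = true := by
  obtain ⟨x, hx⟩ := Option.isSome_iff_exists.1 hk
  exact Option.isSome_iff_exists.2 ⟨x, evaln_mono h hx⟩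

/-- Running a program with a step bound makes enumerability an unbounded search over a primitive
recursive relation that is monotone in the bound. The closure properties below rest on this. -/
theorem _root_.REPred.exists_code {p : α → Prop} (hp : REPred p) :
    ∃ c : Code, ∀ a, p a ↔ ∃ k, (evaln k c (encode a)).isSome = true := by
  obtain ⟨c, hc⟩ := Code.exists_code.1 hp
  refine ⟨c, fun a => ?_⟩
  have h1 : (c.eval (encode a)).Dom ↔ p a := by
    rw [hc]; simp [Part.assert, Part.dom_iff_mem]
  rw [← h1, Part.dom_iff_mem]
  simp only [evaln_complete, Option.isSome_iff_exists, Option.mem_def]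
  exact exists_comm

theorem _root_.PrimrecRel.re_exists_nat {R : α → ℕ → Prop} (hR : PrimrecRel R) :
    REPred fun a => ∃ n, R a n := by
  classical
  have h : Partrec fun a => Nat.rfind fun n => (Part.some (decide (R a n)) : Part Bool) :=
    Partrec.rfind hR.decide.to_comp.partrec
  refine h.dom_re.of_eq fun a => ?_
  rw [Part.dom_iff_mem]
  constructor
  · rintro ⟨n, hn⟩
    have := Nat.rfind_spec hn
    exact ⟨n, by simpa using this⟩
  · rintro ⟨n, hn⟩
    exact Part.dom_iff_mem.1 (Nat.rfind_dom.2 ⟨n, by simpa using hn, fun _ => trivial⟩)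

theorem _root_.REPred.comp {p : β → Prop} (hp : REPred p) {f : α → β} (hf : Computable f) :
    REPred fun a => p (f a) :=
  Partrec.comp hp hf

theorem _root_.PrimrecPred.re {p : α → Prop} (hp : PrimrecPred p) : REPred p :=
  (PrimrecRel.re_exists_nat (R := fun a (_ : ℕ) => p a) (hp.comp Primrec.fst)).of_eq
    fun _ => by simp

/-- Dovetailing: a single number encodes both the step bound and the candidate `b`. -/
theorem _root_.REPred.exists_snd {p : α × β → Prop} (hp : REPred p) :
    REPred fun a => ∃ b, p (a, b) := by
  obtain ⟨c, hc⟩ := hp.exists_code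
  have h : PrimrecRel fun (a : α) (n : ℕ) => ((decode (α := β) n.unpair.2).bind
      fun b => evaln n.unpair.1 c (encode (a, b))).isSome = true := by
    refine Primrec.eq.comp (Primrec.option_isSome.comp (Primrec.option_bind
      (Primrec.decode.comp (Primrec.snd.comp (Primrec.unpair.comp Primrec.snd))) ?_))
      (Primrec.const true)
    exact primrec_evaln.comp (((Primrec.fst.comp (Primrec.unpair.comp
      (Primrec.snd.comp Primrec.fst))).pair (Primrec.const c)).pair
      (Primrec.encode.comp ((Primrec.fst.comp Primrec.fst).pair Primrec.snd)))
  refine h.re_exists_nat.of_eq fun a => ?_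
  constructor
  · rintro ⟨n, hn⟩
    obtain ⟨y, hy⟩ := Option.isSome_iff_exists.1 hn
    obtain ⟨b, -, hb⟩ := Option.bind_eq_some_iff.1 hy
    exact ⟨b, (hc _).2 ⟨n.unpair.1, Option.isSome_iff_exists.2 ⟨y, hb⟩⟩⟩
  · rintro ⟨b, hb⟩
    obtain ⟨k, hk⟩ := (hc _).1 hb
    exact ⟨Nat.pair k (encode b), by simpa using hk⟩

theorem _root_.REPred.and {p q : α → Prop} (hp : REPred p) (hq : REPred q) :
    REPred fun a => p a ∧ q a := by
  obtain ⟨c, hc⟩ := hp.exists_code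
  obtain ⟨d, hd⟩ := hq.exists_code
  have h : PrimrecRel fun (a : α) (k : ℕ) => (evaln k c (encode a)).isSome = true ∧
      (evaln k d (encode a)).isSome = true :=
    PrimrecPred.and (primrecRel_evaln_isSome c) (primrecRel_evaln_isSome d)
  refine h.re_exists_nat.of_eq fun a => ?_
  rw [hc, hd]
  constructor
  · rintro ⟨n, h1, h2⟩
    exact ⟨⟨n, h1⟩, ⟨n, h2⟩⟩
  · rintro ⟨⟨n, h1⟩, ⟨m, h2⟩⟩
    exact ⟨max n m, evaln_isSome_mono (le_max_left _ _) h1,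
      evaln_isSome_mono (le_max_right _ _) h2⟩

theorem _root_.REPred.or {p q : α → Prop} (hp : REPred p) (hq : REPred q) :
    REPred fun a => p a ∨ q a := by
  obtain ⟨c, hc⟩ := hp.exists_code
  obtain ⟨d, hd⟩ := hq.exists_code
  have h : PrimrecRel fun (a : α) (k : ℕ) => (evaln k c (encode a)).isSome = true ∨
      (evaln k d (encode a)).isSome = true :=
    PrimrecPred.or (primrecRel_evaln_isSome c) (primrecRel_evaln_isSome d)
  refine h.re_exists_nat.of_eq fun a => ?_
  rw [hc, hd, exists_or]

theorem _root_.REPred.forall_mem_list {p : β → Prop} (hp : REPred p) :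
    REPred fun l : List β => ∀ b ∈ l, p b := by
  obtain ⟨c, hc⟩ := hp.exists_code
  refine (primrecRel_evaln_isSome c).forall_mem_list.re_exists_nat.of_eq fun l => ?_
  constructor
  · rintro ⟨n, hn⟩ b hb
    exact (hc b).2 ⟨n, hn b hb⟩
  · intro h
    induction l with
    | nil => exact ⟨0, by simp⟩
    | cons a l ih =>
      obtain ⟨n, hn⟩ := ih fun b hb => h b (List.mem_cons_of_mem _ hb)
      obtain ⟨m, hm⟩ := (hc a).1 (h a List.mem_cons_self)
      refine ⟨max m n, fun b hb => ?_⟩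
      rcases List.mem_cons.1 hb with rfl | hb
      · exact evaln_isSome_mono (le_max_left _ _) hm
      · exact evaln_isSome_mono (le_max_right _ _) (hn b hb)

/-- The elements of `α` whose code is less than `s`. -/
def initList (α : Type*) [Primcodable α] (s : ℕ) : List α :=
  (List.range s).filterMap (decode₂ α)

theorem mem_initList {s : ℕ} {x : α} : x ∈ initList α s ↔ encode x < s := by
  simp only [initList, List.mem_filterMap, List.mem_range]
  constructor
  · rintro ⟨m, hm, hx⟩
    rwa [(Encodable.decode₂_eq_some).1 hx]
  · intro h
    exact ⟨_, h, Encodable.decode₂_eq_some.2 rfl⟩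

theorem nodup_initList (s : ℕ) : (initList α s).Nodup := by
  refine List.Nodup.filterMap ?_ List.nodup_range
  intro m n x hm hn
  rw [Option.mem_def, Encodable.decode₂_eq_some] at hm hn
  exact hm.symm.trans hn

theorem primrec_initList : Primrec (initList α) :=
  Primrec.listFilterMap Primrec.list_range (Primrec.decode₂.comp Primrec.snd)

/-- The finite part, obtained in `s` steps, of the section at `b` of the set enumerated by the
code `c`. -/
def stage (α : Type*) {β : Type*} [Primcodable α] [Primcodable β] (c : Code) (b : β) (s : ℕ) :
    List α :=
  (initList α s).filterMap fun x => (evaln s c (encode (b, x))).map fun _ => x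

theorem mem_stage {c : Code} {b : β} {s : ℕ} {x : α} :
    x ∈ stage α c b s ↔ encode x < s ∧ (evaln s c (encode (b, x))).isSome = true := by
  simp only [stage, List.mem_filterMap, mem_initList, Option.map_eq_some_iff,
    Option.isSome_iff_exists]
  constructor
  · rintro ⟨y, hy, z, hz, rfl⟩
    exact ⟨hy, z, hz⟩
  · rintro ⟨hy, z, hz⟩
    exact ⟨x, hy, z, hz, rfl⟩

theorem stage_mono {c : Code} {b : β} {s t : ℕ} (h : s ≤ t) {x : α} (hx : x ∈ stage α c b s) :
    x ∈ stage α c b t :=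
  mem_stage.2 ⟨(mem_stage.1 hx).1.trans_le h, evaln_isSome_mono h (mem_stage.1 hx).2⟩

theorem primrec_stage : Primrec fun p : (Code × β) × ℕ => stage α p.1.1 p.1.2 p.2 := by
  refine Primrec.listFilterMap (primrec_initList.comp Primrec.snd) ?_
  refine Primrec.option_map ?_ (Primrec.snd.comp Primrec.fst)
  exact primrec_evaln.comp (((Primrec.snd.comp Primrec.fst).pair
    (Primrec.fst.comp (Primrec.fst.comp Primrec.fst))).pair (Primrec.encode.comp
      ((Primrec.snd.comp (Primrec.fst.comp Primrec.fst)).pair Primrec.snd)))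

theorem _root_.REPred.exists_stage {p : β × α → Prop} (hp : REPred p) :
    ∃ c : Code, ∀ b x, p (b, x) ↔ ∃ s, x ∈ stage α c b s := by
  obtain ⟨c, hc⟩ := hp.exists_code
  refine ⟨c, fun b x => ?_⟩
  rw [hc]
  simp only [mem_stage]
  constructor
  · rintro ⟨k, hk⟩
    exact ⟨max k (encode x + 1), by omega, evaln_isSome_mono (le_max_left _ _) hk⟩
  · rintro ⟨s, -, hs⟩
    exact ⟨s, hs⟩

end Enumerability

/-! ### Primitive recursive operations on lists -/

section PrimrecLists

variable {α : Type*} [Primcodable α]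

/-- Lets `GoodStage` range over all finite sets of strings below a bound while remaining decidable.
-/
theorem primrec_sublists' : Primrec (List.sublists' : List α → List (List α)) := by
  have h : Primrec fun l : List α => l.foldr (fun a r => r ++ r.map (List.cons a)) [[]] := by
    refine Primrec.list_foldr (h := fun _ (p : α × List (List α)) =>
      p.2 ++ p.2.map (List.cons p.1)) Primrec.id (Primrec.const _) ?_
    refine Primrec.list_append.comp (Primrec.snd.comp Primrec.snd)
      (Primrec.list_map (Primrec.snd.comp Primrec.snd) ?_)
    exact Primrec.list_cons.comp (Primrec.fst.comp (Primrec.snd.comp Primrec.fst)) Primrec.snd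
  refine h.of_eq fun l => ?_
  induction l with
  | nil => rfl
  | cons a l ih => rw [List.foldr_cons, ih, List.sublists'_cons]

theorem primrecRel_prefix : PrimrecRel fun x y : List α => x <+: y :=
  PrimrecPred.of_eq (Primrec.eq.comp Primrec.fst
    (Primrec.list_take.comp (Primrec.list_length.comp Primrec.fst) Primrec.snd))
    fun _ => List.prefix_iff_eq_take.symm

end PrimrecLists

/-! ### Arithmetic of rationals coded as pairs -/

section Rationals

theorem rat_lt_iff {p q : ℕ × ℕ} : rat p < rat q ↔ p.1 * (q.2 + 1) < q.1 * (p.2 + 1) := by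
  rw [rat, rat, div_lt_div_iff₀ (by positivity) (by positivity)]
  exact_mod_cast Iff.rfl

theorem primrecRel_rat_lt : PrimrecRel fun p q => rat p < rat q := by
  have h : PrimrecRel fun p q : ℕ × ℕ => p.1 * (q.2 + 1) < q.1 * (p.2 + 1) :=
    Primrec.nat_lt.comp
      (Primrec.nat_mul.comp (Primrec.fst.comp Primrec.fst)
        (Primrec.succ.comp (Primrec.snd.comp Primrec.snd)))
      (Primrec.nat_mul.comp (Primrec.fst.comp Primrec.snd)
        (Primrec.succ.comp (Primrec.snd.comp Primrec.fst)))
  exact h.of_eq fun _ _ => rat_lt_iff.symm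

/-- Addition of nonnegative rationals given as pairs. -/
def ratAdd (p q : ℕ × ℕ) : ℕ × ℕ :=
  (p.1 * (q.2 + 1) + q.1 * (p.2 + 1), (p.2 + 1) * (q.2 + 1) - 1)

theorem rat_ratAdd (p q : ℕ × ℕ) : rat (ratAdd p q) = rat p + rat q := by
  have h : (((p.2 + 1) * (q.2 + 1) - 1 : ℕ) : ℝ≥0) + 1 = (p.2 + 1) * (q.2 + 1) := by
    have : (p.2 + 1) * (q.2 + 1) - 1 + 1 = (p.2 + 1) * (q.2 + 1) :=
      Nat.sub_add_cancel (Nat.mul_pos (Nat.succ_pos _) (Nat.succ_pos _))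
    exact_mod_cast this
  simp only [rat, ratAdd, h]
  rw [div_add_div _ _ (by positivity) (by positivity)]
  push_cast
  ring

theorem primrec_ratAdd : Primrec₂ ratAdd := by
  have h1 : Primrec fun r : (ℕ × ℕ) × (ℕ × ℕ) => r.1.2 + 1 :=
    Primrec.succ.comp (Primrec.snd.comp Primrec.fst)
  have h2 : Primrec fun r : (ℕ × ℕ) × (ℕ × ℕ) => r.2.2 + 1 :=
    Primrec.succ.comp (Primrec.snd.comp Primrec.snd)
  exact Primrec.pair (Primrec.nat_add.comp
    (Primrec.nat_mul.comp (Primrec.fst.comp Primrec.fst) h2)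
    (Primrec.nat_mul.comp (Primrec.fst.comp Primrec.snd) h1))
    (Primrec.nat_sub.comp (Primrec.nat_mul.comp h1 h2) (Primrec.const 1))

/-- Multiplication of nonnegative rationals given as pairs. -/
def ratMul (p q : ℕ × ℕ) : ℕ × ℕ := (p.1 * q.1, (p.2 + 1) * (q.2 + 1) - 1)

theorem rat_ratMul (p q : ℕ × ℕ) : rat (ratMul p q) = rat p * rat q := by
  have h : (((p.2 + 1) * (q.2 + 1) - 1 : ℕ) : ℝ≥0) + 1 = (p.2 + 1) * (q.2 + 1) := by
    have : (p.2 + 1) * (q.2 + 1) - 1 + 1 = (p.2 + 1) * (q.2 + 1) :=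
      Nat.sub_add_cancel (Nat.mul_pos (Nat.succ_pos _) (Nat.succ_pos _))
    exact_mod_cast this
  simp only [rat, ratMul, h]
  rw [div_mul_div_comm]
  push_cast
  rfl

theorem primrec_ratMul : Primrec₂ ratMul := by
  have h1 : Primrec fun r : (ℕ × ℕ) × (ℕ × ℕ) => r.1.2 + 1 :=
    Primrec.succ.comp (Primrec.snd.comp Primrec.fst)
  have h2 : Primrec fun r : (ℕ × ℕ) × (ℕ × ℕ) => r.2.2 + 1 :=
    Primrec.succ.comp (Primrec.snd.comp Primrec.snd)
  exact Primrec.pair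
    (Primrec.nat_mul.comp (Primrec.fst.comp Primrec.fst) (Primrec.fst.comp Primrec.snd))
    (Primrec.nat_sub.comp (Primrec.nat_mul.comp h1 h2) (Primrec.const 1))

/-- The sum of a list of nonnegative rationals given as pairs. -/
def ratSum (l : List (ℕ × ℕ)) : ℕ × ℕ := l.foldr ratAdd (0, 0)

theorem rat_zero : rat (0, 0) = 0 := by simp [rat]

theorem rat_ratSum (l : List (ℕ × ℕ)) : rat (ratSum l) = (l.map rat).sum := by
  induction l with
  | nil => simp [ratSum, rat_zero]
  | cons p l ih => rw [List.map_cons, List.sum_cons, ← ih, ← rat_ratAdd]; rfl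

theorem primrec_ratSum : Primrec ratSum :=
  Primrec.list_foldr (h := fun _ p => ratAdd p.1 p.2) Primrec.id (Primrec.const _)
    (primrec_ratAdd.comp (Primrec.fst.comp Primrec.snd) (Primrec.snd.comp Primrec.snd))

/-- The larger of two nonnegative rationals given as pairs. -/
def ratMax (p q : ℕ × ℕ) : ℕ × ℕ := if rat p < rat q then q else p

theorem rat_ratMax (p q : ℕ × ℕ) : rat (ratMax p q) = max (rat p) (rat q) := by
  unfold ratMax
  split_ifs with h
  · exact (max_eq_right h.le).symm
  · exact (max_eq_left (not_lt.1 h)).symm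

theorem primrec_ratMax : Primrec₂ ratMax :=
  Primrec.ite primrecRel_rat_lt Primrec.snd Primrec.fst

/-- The maximum of a list of nonnegative rationals given as pairs. -/
def ratSup (l : List (ℕ × ℕ)) : ℕ × ℕ := l.foldr ratMax (0, 0)

theorem le_ratSup {l : List (ℕ × ℕ)} {q : ℕ × ℕ} (h : q ∈ l) : rat q ≤ rat (ratSup l) := by
  induction l with
  | nil => simp at h
  | cons p l ih =>
    have h1 : rat (ratSup (p :: l)) = max (rat p) (rat (ratSup l)) := rat_ratMax _ _
    rw [h1]
    rcases List.mem_cons.1 h with rfl | h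
    · exact le_max_left _ _
    · exact (ih h).trans (le_max_right _ _)

theorem ratSup_le {l : List (ℕ × ℕ)} {b : ℝ≥0} (h : ∀ q ∈ l, rat q ≤ b) : rat (ratSup l) ≤ b := by
  induction l with
  | nil => simp [ratSup, rat_zero]
  | cons p l ih =>
    have h1 : rat (ratSup (p :: l)) = max (rat p) (rat (ratSup l)) := rat_ratMax _ _
    rw [h1]
    exact max_le (h p List.mem_cons_self) (ih fun q hq => h q (List.mem_cons_of_mem _ hq))

theorem primrec_ratSup : Primrec ratSup :=
  Primrec.list_foldr (h := fun _ p => ratMax p.1 p.2) Primrec.id (Primrec.const _)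
    (primrec_ratMax.comp (Primrec.fst.comp Primrec.snd) (Primrec.snd.comp Primrec.snd))

theorem rat_two_pow (k : ℕ) : rat (2 ^ k, 0) = 2 ^ k := by simp [rat]

theorem primrec_two_pow : Primrec fun k : ℕ => 2 ^ k :=
  (Primrec.nat_rec₁ 1 (f := fun _ n => n * 2)
    (Primrec.nat_mul.comp Primrec.snd (Primrec.const 2))).of_eq fun k => by
    induction k with
    | zero => rfl
    | succ k ih => rw [pow_succ, ← ih]

theorem primrec_rat_two_pow : Primrec fun k : ℕ => ((2 ^ k, 0) : ℕ × ℕ) :=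
  primrec_two_pow.pair (Primrec.const 0)

theorem exists_rat_eq (q : ℚ) (hq : 0 ≤ q) : ∃ p : ℕ × ℕ, rat p = Real.toNNReal q := by
  refine ⟨(q.num.toNat, q.den - 1), ?_⟩
  have h1 : ((q.den - 1 : ℕ) : ℝ) + 1 = q.den := by
    have := q.den_pos
    exact_mod_cast Nat.sub_add_cancel this
  have h2 : ((q.num.toNat : ℕ) : ℝ) = (q.num : ℝ) := by
    exact_mod_cast Int.toNat_of_nonneg (Rat.num_nonneg.2 hq)
  apply NNReal.eq
  rw [Real.coe_toNNReal _ (by exact_mod_cast hq), rat]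
  simp only [NNReal.coe_div, NNReal.coe_add, NNReal.coe_natCast, NNReal.coe_one]
  rw [h1, h2]
  exact_mod_cast Rat.num_div_den q

theorem exists_rat_btwn {a b : ℝ≥0∞} (h : a < b) :
    ∃ p : ℕ × ℕ, a < rat p ∧ (rat p : ℝ≥0∞) < b := by
  obtain ⟨q, hq, h1, h2⟩ := ENNReal.lt_iff_exists_rat_btwn.1 h
  obtain ⟨p, hp⟩ := exists_rat_eq q hq
  exact ⟨p, by rwa [hp], by rwa [hp]⟩

end Rationals

/-! ### Intervals and minimal strings -/

section Cylinders

theorem length_initSeg (ω : Cantor) (n : ℕ) : (initSeg ω n).length = n := by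
  simp [initSeg]

theorem initSeg_prefix (ω : Cantor) {m n : ℕ} (h : m ≤ n) : initSeg ω m <+: initSeg ω n := by
  rw [List.prefix_iff_eq_take]
  refine List.ext_getElem (by simp [initSeg, h]) fun i h1 h2 => ?_
  simp [initSeg]

theorem mem_cyl_initSeg (ω : Cantor) (n : ℕ) : ω ∈ cyl (initSeg ω n) := by
  simp [cyl, length_initSeg]

theorem prefix_of_mem_cyl {ω : Cantor} {x y : Str} (hx : ω ∈ cyl x) (hy : ω ∈ cyl y)
    (h : x.length ≤ y.length) : x <+: y := by
  have := initSeg_prefix ω h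
  rwa [show initSeg ω x.length = x from hx, show initSeg ω y.length = y from hy] at this

theorem cyl_subset_cyl {x y : Str} (h : x <+: y) : cyl y ⊆ cyl x := by
  intro ω hω
  have h1 := initSeg_prefix ω h.length_le
  rw [show initSeg ω y.length = y from hω] at h1
  have h2 := List.prefix_of_prefix_length_le h1 h (length_initSeg _ _).le
  exact h2.eq_of_length (length_initSeg _ _)

theorem measurableSet_cyl (x : Str) : MeasurableSet (cyl x) := by
  have h : cyl x = ⋂ i : Fin x.length, {ω : Cantor | ω i = x[i]} := by
    ext ω
    simp only [Set.mem_iInter, Set.mem_ofPred_eq, cyl]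
    constructor
    · intro h i
      have : (initSeg ω x.length)[i.1]'(by simp [length_initSeg]) = x[i] := by
        simp only [h, Fin.getElem_fin]
      simpa [initSeg] using this
    · intro h
      refine List.ext_getElem (length_initSeg _ _) fun i h1 h2 => ?_
      simpa [initSeg] using h ⟨i, h2⟩
  rw [h]
  exact MeasurableSet.iInter fun i => measurable_pi_apply (i : ℕ) (measurableSet_singleton _)

/-- The elements of a set of strings that have no proper prefix in the set. -/
def minimalStrings (A : Set Str) : Set Str := {x ∈ A | ∀ y ∈ A, y <+: x → y = x}

theorem prefixFree_minimalStrings (A : Set Str) : PrefixFree (minimalStrings A) :=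
  fun x hx _ hy h => hy.2 x hx.1 h

theorem exists_minimalStrings_prefix {A : Set Str} {x : Str} (hx : x ∈ A) :
    ∃ y ∈ minimalStrings A, y <+: x := by
  induction h : x.length using Nat.strong_induction_on generalizing x with
  | _ n ih =>
    by_cases hm : x ∈ minimalStrings A
    · exact ⟨x, hm, List.prefix_rfl⟩
    · have : ∃ y ∈ A, y <+: x ∧ y ≠ x := by
        by_contra! hc
        exact hm ⟨hx, hc⟩
      obtain ⟨y, hy, hyx, hne⟩ := this
      have hlt : y.length < n := by
        rw [← h]
        exact lt_of_le_of_ne hyx.length_le fun he => hne (hyx.eq_of_length he)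
      obtain ⟨z, hz, hzy⟩ := ih _ hlt hy rfl
      exact ⟨z, hz, hzy.trans hyx⟩

theorem biUnion_minimalStrings (A : Set Str) : ⋃ x ∈ minimalStrings A, cyl x = ⋃ x ∈ A, cyl x := by
  apply Set.Subset.antisymm
  · exact Set.biUnion_subset_biUnion_left fun x hx => hx.1
  · refine Set.iUnion₂_subset fun x hx => ?_
    obtain ⟨y, hy, hyx⟩ := exists_minimalStrings_prefix hx
    exact (cyl_subset_cyl hyx).trans (Set.subset_biUnion_of_mem (u := cyl) hy)

/-- Every string of `A` extends a minimal one, so the minimal strings give the same union; being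
prefix-free, they have disjoint intervals. -/
theorem measure_biUnion_cyl (μ : Measure Cantor) (A : Set Str) :
    μ (⋃ x ∈ A, cyl x) = ∑' x : minimalStrings A, μ (cyl x) := by
  rw [← biUnion_minimalStrings]
  refine measure_biUnion (Set.to_countable _) ?_ fun x _ => measurableSet_cyl x
  intro x hx y hy hne
  refine Set.disjoint_left.2 fun ω h1 h2 => hne ?_
  rcases le_total x.length y.length with h | h
  · exact prefixFree_minimalStrings A x hx y hy (prefix_of_mem_cyl h1 h2 h)
  · exact (prefixFree_minimalStrings A y hy x hx (prefix_of_mem_cyl h2 h1 h)).symm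

end Cylinders

/-! ### Lower semicomputable functions on strings via their subgraphs -/

section SemicomputableStr

theorem basic_eq_ratSum (L : List (Str × (ℕ × ℕ))) (x : Str) :
    basic L x = rat (ratSum (L.map fun p => if p.1 = x then p.2 else (0, 0))) := by
  rw [rat_ratSum, basic, List.map_map]
  congr 1
  refine List.map_congr_left fun p _ => ?_
  simp only [Function.comp]
  split_ifs
  · rfl
  · exact rat_zero.symm

theorem primrecPred_lt_basic :
    PrimrecPred fun p : ((ℕ × ℕ) × Str) × List (Str × (ℕ × ℕ)) => rat p.1.1 < basic p.2 p.1.2 := by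
  have h : PrimrecPred fun p : ((ℕ × ℕ) × Str) × List (Str × (ℕ × ℕ)) =>
      rat p.1.1 < rat (ratSum (p.2.map fun r => if r.1 = p.1.2 then r.2 else (0, 0))) := by
    refine primrecRel_rat_lt.comp (Primrec.fst.comp Primrec.fst)
      (primrec_ratSum.comp (Primrec.list_map Primrec.snd ?_))
    exact Primrec.ite (Primrec.eq.comp (Primrec.fst.comp Primrec.snd)
      (Primrec.snd.comp (Primrec.fst.comp Primrec.fst))) (Primrec.snd.comp Primrec.snd)
      (Primrec.const _)
  exact h.of_eq fun p => by rw [basic_eq_ratSum]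

theorem LowerSemicomputableStr.rePred {a : Str → ℝ≥0} (ha : LowerSemicomputableStr a) :
    REPred fun p : (ℕ × ℕ) × Str => rat p.1 < a p.2 := by
  obtain ⟨f, hf, hm, ht⟩ := ha
  have h : REPred fun p : ((ℕ × ℕ) × Str) × ℕ => rat p.1.1 < basic (f p.2) p.1.2 :=
    REPred.comp (f := fun p : ((ℕ × ℕ) × Str) × ℕ => (p.1, f p.2)) primrecPred_lt_basic.re
      (Computable.fst.pair (hf.comp Computable.snd))
  refine h.exists_snd.of_eq fun p => ?_
  constructor
  · rintro ⟨n, hn⟩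
    exact hn.trans_le (Monotone.ge_of_tendsto (fun i j hij => hm hij p.2) (ht p.2) n)
  · intro h
    exact ((ht p.2).eventually (lt_mem_nhds h)).exists

theorem basic_filterMap_range (g : Str → ℕ × ℕ) (n : ℕ) (x : Str) :
    basic ((List.range n).filterMap fun m => (decode₂ Str m).map fun y => (y, g y)) x =
      if encode x < n then rat (g x) else 0 := by
  induction n with
  | zero => simp [basic]
  | succ n ih =>
    rw [List.range_succ, List.filterMap_append]
    have h1 : ∀ L M, basic (L ++ M) x = basic L x + basic M x := by simp [basic]
    rw [h1, ih]
    by_cases hx : encode x = n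
    · have h2 : decode₂ Str n = some x := decode₂_eq_some.2 hx
      simp [h2, hx, basic]
    · have h2 : basic ([n].filterMap fun m => (decode₂ Str m).map fun y => (y, g y)) x = 0 := by
        rcases h : decode₂ Str n with _ | y
        · simp [h, basic]
        · have : y ≠ x := by
            rintro rfl
            exact hx (decode₂_eq_some.1 h)
          simp [h, basic, this]
      rw [h2, add_zero]
      have h3 : encode x < n + 1 ↔ encode x < n := by omega
      simp only [h3]

/-- The `s`-th lower approximation given by the code `c` to a function on strings. -/
def approx (c : Code) (s : ℕ) (x : Str) : ℕ × ℕ :=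
  if encode x < s then ratSup (stage (ℕ × ℕ) c x s) else (0, 0)

theorem primrec_approx : Primrec fun p : (Code × ℕ) × Str => approx p.1.1 p.1.2 p.2 :=
  Primrec.ite (Primrec.nat_lt.comp (Primrec.encode.comp Primrec.snd)
      (Primrec.snd.comp Primrec.fst))
    (primrec_ratSup.comp (primrec_stage.comp (((Primrec.fst.comp Primrec.fst).pair
      Primrec.snd).pair (Primrec.snd.comp Primrec.fst)))) (Primrec.const _)

theorem rat_approx_mono (c : Code) (x : Str) : Monotone fun s => rat (approx c s x) := by
  intro s t h
  simp only [approx]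
  split_ifs with h1 h2
  · exact ratSup_le fun q hq => le_ratSup (stage_mono h hq)
  · omega
  · simp [rat_zero]
  · rfl

theorem rat_approx_le {c : Code} {s : ℕ} {x : Str} {b : ℝ≥0}
    (h : ∀ q ∈ stage (ℕ × ℕ) c x s, rat q ≤ b) : rat (approx c s x) ≤ b := by
  unfold approx
  split_ifs
  · exact ratSup_le h
  · simp [rat_zero]

theorem exists_le_approx {c : Code} {s : ℕ} {x : Str} {q : ℕ × ℕ}
    (h : q ∈ stage (ℕ × ℕ) c x s) : ∃ t, rat q ≤ rat (approx c t x) := by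
  refine ⟨max s (encode x + 1), ?_⟩
  rw [approx, if_pos (by omega)]
  exact le_ratSup (stage_mono (le_max_left _ _) h)

/-- The `n`-th basic function takes, at each string of code below `n`, the largest rational found in
`n` steps. Density of the rationals makes `a` the supremum. -/
theorem lowerSemicomputableStr_of_rePred {a : Str → ℝ≥0}
    (ha : REPred fun p : (ℕ × ℕ) × Str => rat p.1 < a p.2) : LowerSemicomputableStr a := by
  have ha' : REPred fun p : Str × (ℕ × ℕ) => rat p.2 < a p.1 :=
    REPred.comp (f := fun p : Str × (ℕ × ℕ) => (p.2, p.1)) ha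
      (Computable.snd.pair Computable.fst)
  obtain ⟨c, hc⟩ := ha'.exists_stage
  have hb : ∀ n x, basic ((List.range n).filterMap fun m => (decode₂ Str m).map fun y =>
      (y, approx c n y)) x = rat (approx c n x) := by
    intro n x
    rw [basic_filterMap_range (approx c n)]
    split_ifs with h
    · rfl
    · rw [approx, if_neg h, rat_zero]
  refine ⟨fun n => (List.range n).filterMap fun m => (decode₂ Str m).map fun y =>
      (y, approx c n y), Primrec.to_comp ?_, ?_, ?_⟩
  · refine Primrec.listFilterMap Primrec.list_range ?_
    refine Primrec.option_map (Primrec.decode₂.comp Primrec.snd) ?_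
    exact Primrec.snd.pair (primrec_approx.comp (((Primrec.const c).pair
      (Primrec.fst.comp Primrec.fst)).pair Primrec.snd))
  · intro m n h x
    simp only [hb]
    exact rat_approx_mono c x h
  · intro x
    simp only [hb]
    refine tendsto_atTop_isLUB (rat_approx_mono c x) ⟨?_, ?_⟩
    · rintro _ ⟨s, rfl⟩
      exact rat_approx_le fun q hq => ((hc x q).2 ⟨s, hq⟩).le
    · intro b hb
      by_contra! hlt
      obtain ⟨q, hq1, hq2⟩ := exists_rat_btwn (ENNReal.coe_lt_coe.2 hlt)
      rw [ENNReal.coe_lt_coe] at hq1 hq2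
      obtain ⟨s, hs⟩ := (hc x q).1 hq2
      obtain ⟨t, ht⟩ := exists_le_approx hs
      exact absurd (hq1.trans_le (ht.trans (hb ⟨t, rfl⟩))) (lt_irrefl _)

end SemicomputableStr

/-! ### The continuous a priori probability -/

section Universal

/-- The approximation given by `c` in `s` steps satisfies the semimeasure inequality. -/
def GoodStage (c : Code) (s : ℕ) : Prop :=
  ∀ T ∈ (initList Str s).sublists', (∀ y ∈ T, ∀ x ∈ T, x <+: y → x = y) →
    ¬ rat (1, 0) < rat (ratSum (T.map (approx c s)))

theorem primrecRel_goodStage : PrimrecRel GoodStage := by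
  have hP : PrimrecPred fun T : List Str => ∀ y ∈ T, ∀ x ∈ T, x <+: y → x = y := by
    have h : PrimrecRel fun x y : Str => x <+: y → x = y :=
      (PrimrecPred.or primrecRel_prefix.not Primrec.eq : PrimrecPred fun p : Str × Str =>
        ¬ p.1 <+: p.2 ∨ p.1 = p.2).of_eq fun p => by tauto
    exact (h.forall_mem_list.swap.forall_mem_list).comp Primrec.id Primrec.id
  have hR : PrimrecRel fun (T : List Str) (p : Code × ℕ) =>
      (∀ y ∈ T, ∀ x ∈ T, x <+: y → x = y) →
        ¬ rat (1, 0) < rat (ratSum (T.map (approx p.1 p.2))) := by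
    have h : PrimrecPred fun r : List Str × (Code × ℕ) =>
        ¬ (∀ y ∈ r.1, ∀ x ∈ r.1, x <+: y → x = y) ∨
          ¬ rat (1, 0) < rat (ratSum (r.1.map (approx r.2.1 r.2.2))) := by
      refine (hP.comp Primrec.fst).not.or (primrecRel_rat_lt.comp (Primrec.const _)
        (primrec_ratSum.comp (Primrec.list_map Primrec.fst ?_))).not
      exact primrec_approx.comp ((Primrec.snd.comp Primrec.fst).pair Primrec.snd)
    exact h.of_eq fun r => by tauto
  exact hR.forall_mem_list.comp (primrec_sublists'.comp (primrec_initList.comp Primrec.snd))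
    Primrec.id

theorem sum_map_toFinset {α M : Type*} [DecidableEq α] [AddCommMonoid M] {T : List α}
    (hT : T.Nodup) (g : α → M) : (T.map g).sum = ∑ x ∈ T.toFinset, g x :=
  (List.sum_toFinset g hT).symm

/-- Strings outside `initList Str s` have approximation zero, so the finitely many sublists tested
account for every finite prefix-free set. -/
theorem GoodStage.sum_le {c : Code} {s : ℕ} (h : GoodStage c s) (S : Finset Str)
    (hS : PrefixFree (S : Set Str)) : ∑ x ∈ S, rat (approx c s x) ≤ 1 := by
  have hT : ((initList Str s).filter (· ∈ S)).Nodup := (nodup_initList s).filter _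
  have h1 := h ((initList Str s).filter (· ∈ S)) (List.mem_sublists'.2 List.filter_sublist)
    (fun y hy x hx hxy => hS x (by simpa using (List.mem_filter.1 hx).2) y
      (by simpa using (List.mem_filter.1 hy).2) hxy)
  rw [rat_ratSum, List.map_map, sum_map_toFinset hT, not_lt] at h1
  have h2 : rat (1, 0) = 1 := by simp [rat]
  rw [h2] at h1
  refine le_trans (le_of_eq ?_) h1
  symm
  refine Finset.sum_subset (fun x hx => (by simpa using hx : _ ∧ _).2)
    fun x hx hx' => ?_
  have : ¬ encode x < s := fun hlt => hx' (by simp [mem_initList, hlt, hx])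
  simp [approx, this, rat_zero]

theorem goodStage_of_forall_le {c : Code} {a : Str → ℝ≥0} (s : ℕ)
    (ha : ∀ S : Set Str, PrefixFree S → ∑' x : S, (a (x : Str) : ℝ≥0∞) ≤ 1)
    (hc : ∀ x, rat (approx c s x) ≤ a x) : GoodStage c s := by
  intro T hT hP
  have hn : T.Nodup := (nodup_initList s).sublist (List.mem_sublists'.1 hT)
  rw [rat_ratSum, List.map_map, sum_map_toFinset hn, not_lt]
  have h1 := ha (T.toFinset : Set Str) fun x hx y hy hxy =>
    hP y (by simpa using hy) x (by simpa using hx) hxy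
  rw [Finset.tsum_subtype' T.toFinset fun x => (a x : ℝ≥0∞)] at h1
  have h2 : ∑ x ∈ T.toFinset, a x ≤ 1 := by exact_mod_cast h1
  have h3 : rat (1, 0) = 1 := by simp [rat]
  rw [h3]
  exact (Finset.sum_le_sum fun x _ => hc x).trans h2

/-- The semimeasure generated by the code `c`. -/
def codeSemimeasure (c : Code) (x : Str) : ℝ≥0∞ :=
  ⨆ s : {s // GoodStage c s}, (rat (approx c s x) : ℝ≥0∞)

/-- The approximations increase with the stage, so the finite sum commutes with the supremum over
accepted stages. -/
theorem sum_codeSemimeasure_le (c : Code) (S : Finset Str) (hS : PrefixFree (S : Set Str)) :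
    ∑ x ∈ S, codeSemimeasure c x ≤ 1 := by
  simp only [codeSemimeasure]
  rw [ENNReal.finsetSum_iSup_of_monotone]
  · refine iSup_le fun s => ?_
    exact_mod_cast s.2.sum_le S hS
  · intro x s t h
    exact ENNReal.coe_le_coe.2 (rat_approx_mono c x h)

theorem tsum_two_pow_code : ∑' c : Code, (2⁻¹ : ℝ≥0∞) ^ (encode c + 1) ≤ 1 := by
  refine (ENNReal.tsum_comp_le_tsum_of_injective (encode_injective (α := Code))
    fun n => (2⁻¹ : ℝ≥0∞) ^ (n + 1)).trans ?_
  rw [ENNReal.tsum_geometric_add_one]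
  simp [ENNReal.one_sub_inv_two, ENNReal.inv_mul_cancel]

/-- A universal semimeasure, with values in `[0, ∞]`. -/
def universalSemimeasure (x : Str) : ℝ≥0∞ :=
  ⨆ c : Code, (2⁻¹ : ℝ≥0∞) ^ (encode c + 1) * codeSemimeasure c x

/-- The supremum over programs is at most the weighted sum, whose weights total at most 1. Using a
supremum keeps the strict subgraph a plain existential statement. -/
theorem sum_universalSemimeasure_le (S : Finset Str) (hS : PrefixFree (S : Set Str)) :
    ∑ x ∈ S, universalSemimeasure x ≤ 1 := by
  calc ∑ x ∈ S, universalSemimeasure x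
      ≤ ∑ x ∈ S, ∑' c : Code, (2⁻¹ : ℝ≥0∞) ^ (encode c + 1) * codeSemimeasure c x :=
        Finset.sum_le_sum fun x _ => iSup_le fun c => ENNReal.le_tsum c
    _ = ∑' c : Code, (2⁻¹ : ℝ≥0∞) ^ (encode c + 1) * ∑ x ∈ S, codeSemimeasure c x := by
        simp only [Finset.mul_sum]
        exact (Summable.tsum_finsetSum fun _ _ => ENNReal.summable).symm
    _ ≤ ∑' c : Code, (2⁻¹ : ℝ≥0∞) ^ (encode c + 1) * 1 :=
        ENNReal.tsum_le_tsum fun c => by gcongr; exact sum_codeSemimeasure_le c S hS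
    _ ≤ 1 := by simpa using tsum_two_pow_code

theorem universalSemimeasure_ne_top (x : Str) : universalSemimeasure x ≠ ∞ := by
  have h := sum_universalSemimeasure_le {x} (by intro y hy z hz _; simp_all)
  rw [Finset.sum_singleton] at h
  exact ne_top_of_le_ne_top ENNReal.one_ne_top h

theorem lt_universalSemimeasure_iff (q : ℕ × ℕ) (x : Str) :
    (rat q : ℝ≥0∞) < universalSemimeasure x ↔ ∃ r : Code × ℕ, GoodStage r.1 r.2 ∧
      rat (ratMul q (2 ^ (encode r.1 + 1), 0)) < rat (approx r.1 r.2 x) := by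
  simp only [universalSemimeasure, codeSemimeasure, ENNReal.mul_iSup, lt_iSup_iff, Prod.exists,
    Subtype.exists, exists_prop]
  refine exists_congr fun c => exists_congr fun s => and_congr_right fun _ => ?_
  rw [rat_ratMul, rat_two_pow, ← ENNReal.coe_lt_coe, ← ENNReal.inv_pow, mul_comm,
    ← div_eq_mul_inv, ENNReal.lt_div_iff_mul_lt (by simp) (by simp)]
  push_cast
  rfl

theorem exists_isAPriori : ∃ a, IsAPriori a := by
  have hcoe : ∀ x, ((universalSemimeasure x).toNNReal : ℝ≥0∞) = universalSemimeasure x :=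
    fun x => ENNReal.coe_toNNReal (universalSemimeasure_ne_top x)
  refine ⟨fun x => (universalSemimeasure x).toNNReal, ⟨lowerSemicomputableStr_of_rePred ?_, ?_⟩, ?_⟩
  · have h : PrimrecPred fun p : ((ℕ × ℕ) × Str) × (Code × ℕ) => GoodStage p.2.1 p.2.2 ∧
        rat (ratMul p.1.1 (2 ^ (encode p.2.1 + 1), 0)) < rat (approx p.2.1 p.2.2 p.1.2) := by
      refine (PrimrecPred.comp primrecRel_goodStage Primrec.snd).and (primrecRel_rat_lt.comp
        (primrec_ratMul.comp (Primrec.fst.comp Primrec.fst) (primrec_rat_two_pow.comp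
          (Primrec.succ.comp (Primrec.encode.comp (Primrec.fst.comp Primrec.snd))))) ?_)
      exact primrec_approx.comp (Primrec.snd.pair (Primrec.snd.comp Primrec.fst))
    refine h.re.exists_snd.of_eq fun p => ?_
    rw [← ENNReal.coe_lt_coe, hcoe]
    exact (lt_universalSemimeasure_iff p.1 p.2).symm
  · intro S hS
    simp only [hcoe]
    rw [ENNReal.tsum_eq_iSup_sum]
    refine iSup_le fun s => ?_
    refine (Finset.sum_map s (Function.Embedding.subtype (· ∈ S))
      universalSemimeasure).symm.trans_le ?_
    refine sum_universalSemimeasure_le _ fun x hx y hy hxy => ?_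
    have : ∀ z ∈ (s.map (Function.Embedding.subtype (· ∈ S)) : Set Str), z ∈ S := by
      intro z hz
      simp only [Finset.coe_map, Function.Embedding.subtype_apply, Set.mem_image] at hz
      obtain ⟨w, -, rfl⟩ := hz
      exact w.2
    exact hS x (this x hx) y (this y hy) hxy
  · rintro a ⟨ha, hS⟩
    have ha' : REPred fun p : Str × (ℕ × ℕ) => rat p.2 < a p.1 :=
      REPred.comp (f := fun p : Str × (ℕ × ℕ) => (p.2, p.1)) ha.rePred
        (Computable.snd.pair Computable.fst)
    obtain ⟨c, hc⟩ := ha'.exists_stage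
    -- The approximations never exceed `a`, so no stage is rejected.
    have hg : ∀ s, GoodStage c s := fun s => goodStage_of_forall_le s hS fun x =>
      rat_approx_le fun q hq => ((hc x q).2 ⟨s, hq⟩).le
    have hle : ∀ x, (a x : ℝ≥0∞) ≤ codeSemimeasure c x := by
      intro x
      refine le_of_forall_lt fun b hb => ?_
      obtain ⟨q, hq1, hq2⟩ := exists_rat_btwn hb
      obtain ⟨s, hs⟩ := (hc x q).1 (ENNReal.coe_lt_coe.1 hq2)
      obtain ⟨t, ht⟩ := exists_le_approx hs
      exact hq1.trans_le ((ENNReal.coe_le_coe.2 ht).trans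
        (le_iSup (fun s : {s // GoodStage c s} => (rat (approx c s x) : ℝ≥0∞)) ⟨t, hg t⟩))
    refine ⟨2 ^ (encode c + 1), fun x => ?_⟩
    rw [← ENNReal.coe_le_coe, ENNReal.coe_mul, hcoe]
    refine (hle x).trans ?_
    calc codeSemimeasure c x
        = (2 : ℝ≥0∞) ^ (encode c + 1) * ((2⁻¹ : ℝ≥0∞) ^ (encode c + 1) * codeSemimeasure c x) := by
          rw [← mul_assoc, ← mul_pow, ENNReal.mul_inv_cancel (by simp) (by simp), one_pow, one_mul]
      _ ≤ _ := by
          push_cast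
          gcongr
          exact le_iSup (fun c : Code => (2⁻¹ : ℝ≥0∞) ^ (encode c + 1) * codeSemimeasure c x) c

end Universal

/-! ### Approximating the measure from above -/

section MeasureUpper

variable {μ : Measure Cantor}

theorem IsComputableMeasure.rePred_cyl_lt [IsFiniteMeasure μ] (hμ : IsComputableMeasure μ) :
    REPred fun p : Str × (ℕ × ℕ) => μ (cyl p.1) < rat p.2 := by
  obtain ⟨f, hf, hfe⟩ := hμ
  have h : PrimrecPred fun p : (ℕ × ℕ) × (ℕ × ℕ) × (ℕ × ℕ) =>
      rat (0, 0) < rat p.1 ∧ rat (ratAdd p.2.1 p.1) < rat p.2.2 :=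
    (primrecRel_rat_lt.comp (Primrec.const _) Primrec.fst).and
      (primrecRel_rat_lt.comp (primrec_ratAdd.comp (Primrec.fst.comp Primrec.snd) Primrec.fst)
        (Primrec.snd.comp Primrec.snd))
  have h' := REPred.comp (f := fun p : (Str × (ℕ × ℕ)) × (ℕ × ℕ) => (p.2, f p.1.1 p.2, p.1.2)) h.re
    (Computable.snd.pair ((hf.comp (Computable.fst.comp Computable.fst) Computable.snd).pair
      (Computable.snd.comp Computable.fst)))
  refine h'.exists_snd.of_eq fun p => ?_
  have hm : μ (cyl p.1) < rat p.2 ↔ (μ (cyl p.1)).toReal < (rat p.2 : ℝ) := by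
    rw [← ENNReal.ofReal_coe_nnreal, ENNReal.lt_ofReal_iff_toReal_lt (measure_ne_top _ _)]
  rw [hm]
  simp only [rat_zero, rat_ratAdd]
  constructor
  · rintro ⟨ε, h0, hε⟩
    have h1 := (abs_le.1 (hfe p.1 ε h0)).1
    have h2 : (rat (f p.1 ε) : ℝ) + rat ε < rat p.2 := by exact_mod_cast hε
    linarith
  · intro hlt
    -- With `ε` below half the gap, the approximation plus `ε` is at most `μ + 2ε`, still below the
    -- target.
    have h0 : (0 : ℝ≥0∞) < ENNReal.ofReal (((rat p.2 : ℝ) - (μ (cyl p.1)).toReal) / 2) :=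
      ENNReal.ofReal_pos.2 (by linarith)
    obtain ⟨ε, h1, h2⟩ := exists_rat_btwn h0
    rw [ENNReal.coe_pos] at h1
    rw [← ENNReal.ofReal_coe_nnreal, ENNReal.ofReal_lt_ofReal_iff (by linarith)] at h2
    refine ⟨ε, h1, ?_⟩
    have h3 := (abs_le.1 (hfe p.1 ε h1)).2
    have h4 : (rat (f p.1 ε) : ℝ) + rat ε < rat p.2 := by linarith
    exact_mod_cast h4

theorem measure_biUnion_list_cyl_le (M : List (Str × (ℕ × ℕ)))
    (hM : ∀ r ∈ M, μ (cyl r.1) < rat r.2) :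
    μ (⋃ r ∈ M, cyl r.1) ≤ rat (ratSum (M.map Prod.snd)) := by
  induction M with
  | nil => simp
  | cons r M ih =>
    have h1 : ratSum ((r :: M).map Prod.snd) = ratAdd r.2 (ratSum (M.map Prod.snd)) := rfl
    have h2 : ⋃ p ∈ r :: M, cyl p.1 = cyl r.1 ∪ ⋃ p ∈ M, cyl p.1 := by
      ext ω; simp
    rw [h1, h2, rat_ratAdd, ENNReal.coe_add]
    exact (measure_union_le _ _).trans (add_le_add (hM r List.mem_cons_self).le
      (ih fun p hp => hM p (List.mem_cons_of_mem _ hp)))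

/-- An upper bound is certified by a finite cover with rational bounds on each interval. A good
enough cover exists because the minimal strings compute the measure exactly as a sum. -/
theorem measure_biUnion_cyl_lt_iff [IsFiniteMeasure μ] (F : List Str) (q : ℕ × ℕ) :
    μ (⋃ x ∈ F, cyl x) < rat q ↔ ∃ M : List (Str × (ℕ × ℕ)),
      (∀ r ∈ M, μ (cyl r.1) < rat r.2) ∧ (∀ x ∈ F, ∃ r ∈ M, r.1 <+: x) ∧
        rat (ratSum (M.map Prod.snd)) < rat q := by
  constructor
  · intro h
    have hfin : (minimalStrings {x | x ∈ F}).Finite :=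
      (List.finite_toSet F).subset fun x hx => hx.1
    have h1 : ∑ x ∈ hfin.toFinset, μ (cyl x) < rat q := by
      have h2 := measure_biUnion_cyl μ {x | x ∈ F}
      rw [← hfin.coe_toFinset, Finset.tsum_subtype' hfin.toFinset fun x => μ (cyl x)] at h2
      rw [← h2]
      exact h
    -- The gap below `rat q` is distributed over all strings as rounding errors.
    obtain ⟨ε, hε, hsum⟩ := ENNReal.exists_pos_sum_of_countable' (tsub_pos_of_lt h1).ne' Str
    have hr : ∀ x : Str, ∃ r : ℕ × ℕ, μ (cyl x) < rat r ∧ (rat r : ℝ≥0∞) < μ (cyl x) + ε x :=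
      fun x => exists_rat_btwn (ENNReal.lt_add_right (measure_ne_top _ _) (hε x).ne')
    choose r hr1 hr2 using hr
    refine ⟨hfin.toFinset.toList.map fun x => (x, r x), ?_, ?_, ?_⟩
    · intro p hp
      obtain ⟨x, -, rfl⟩ := List.mem_map.1 hp
      exact hr1 x
    · intro x hx
      obtain ⟨y, hy, hyx⟩ := exists_minimalStrings_prefix (A := {x | x ∈ F}) hx
      exact ⟨(y, r y), List.mem_map.2 ⟨y, by simpa using hy, rfl⟩, hyx⟩
    · rw [rat_ratSum, List.map_map, List.map_map, ← ENNReal.coe_lt_coe]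
      have h3 : (hfin.toFinset.toList.map ((rat ∘ Prod.snd) ∘ fun x => (x, r x))).sum =
          ∑ x ∈ hfin.toFinset, rat (r x) := Finset.sum_map_toList _ _
      rw [h3, ENNReal.ofNNReal_finsetSum]
      calc ∑ x ∈ hfin.toFinset, (rat (r x) : ℝ≥0∞)
          ≤ ∑ x ∈ hfin.toFinset, (μ (cyl x) + ε x) := Finset.sum_le_sum fun x _ => (hr2 x).le
        _ = ∑ x ∈ hfin.toFinset, μ (cyl x) + ∑ x ∈ hfin.toFinset, ε x := Finset.sum_add_distrib
        _ ≤ ∑ x ∈ hfin.toFinset, μ (cyl x) + ∑' x, ε x := by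
            gcongr
            exact ENNReal.sum_le_tsum _
        _ < ∑ x ∈ hfin.toFinset, μ (cyl x) + (rat q - ∑ x ∈ hfin.toFinset, μ (cyl x)) :=
            ENNReal.add_lt_add_left h1.ne_top hsum
        _ = rat q := add_tsub_cancel_of_le h1.le
  · rintro ⟨M, hM, hF, hq⟩
    refine lt_of_le_of_lt ?_ (ENNReal.coe_lt_coe.2 hq)
    refine le_trans (measure_mono ?_) (measure_biUnion_list_cyl_le M hM)
    refine Set.iUnion₂_subset fun x hx => ?_
    obtain ⟨r, hr, hrx⟩ := hF x hx
    exact (cyl_subset_cyl hrx).trans (Set.subset_biUnion_of_mem (s := {r | r ∈ M})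
      (u := fun r : Str × (ℕ × ℕ) => cyl r.1) hr)

theorem IsComputableMeasure.rePred_biUnion_cyl_lt [IsFiniteMeasure μ]
    (hμ : IsComputableMeasure μ) :
    REPred fun p : List Str × (ℕ × ℕ) => μ (⋃ x ∈ p.1, cyl x) < rat p.2 := by
  have h1 : REPred fun p : (List Str × (ℕ × ℕ)) × List (Str × (ℕ × ℕ)) =>
      ∀ r ∈ p.2, μ (cyl r.1) < rat r.2 :=
    REPred.comp (f := fun p : (List Str × (ℕ × ℕ)) × List (Str × (ℕ × ℕ)) => p.2)
      hμ.rePred_cyl_lt.forall_mem_list Computable.snd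
  have h2 : PrimrecPred fun p : (List Str × (ℕ × ℕ)) × List (Str × (ℕ × ℕ)) =>
      ∀ x ∈ p.1.1, ∃ r ∈ p.2, r.1 <+: x := by
    have h : PrimrecRel fun (r : Str × (ℕ × ℕ)) (x : Str) => r.1 <+: x :=
      primrecRel_prefix.comp (Primrec.fst.comp Primrec.fst) Primrec.snd
    exact h.exists_mem_list.swap.forall_mem_list.comp (Primrec.fst.comp Primrec.fst) Primrec.snd
  have h3 : PrimrecPred fun p : (List Str × (ℕ × ℕ)) × List (Str × (ℕ × ℕ)) =>
      rat (ratSum (p.2.map Prod.snd)) < rat p.1.2 :=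
    primrecRel_rat_lt.comp (primrec_ratSum.comp (Primrec.list_map Primrec.snd
      (Primrec.snd.comp Primrec.snd))) (Primrec.snd.comp Primrec.fst)
  exact (h1.and (h2.and h3).re).exists_snd.of_eq fun p =>
    (measure_biUnion_cyl_lt_iff p.1 p.2).symm

end MeasureUpper

/-! ### The universal probability bounded test -/

section UniversalTest

variable (μ : Measure Cantor)

/-- The set of strings enumerated by the section at `k` of the code `c`, as long as the measure of
the union of the corresponding intervals stays below `2 / 2 ^ k`. -/
def trimmed (c : Code) (k : ℕ) : Set Str :=
  {x | ∃ s, (2 : ℝ≥0∞) ^ k * μ (⋃ y ∈ stage Str c k s, cyl y) < 2 ∧ x ∈ stage Str c k s}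

/-- Accepted stages increase with `s`, so continuity from below carries their common bound to the
union. -/
theorem measure_trimmed_le (c : Code) (k : ℕ) :
    μ (⋃ x ∈ trimmed μ c k, cyl x) ≤ 2 * (2⁻¹ : ℝ≥0∞) ^ k := by
  have h : ⋃ x ∈ trimmed μ c k, cyl x =
      ⋃ s : {s // (2 : ℝ≥0∞) ^ k * μ (⋃ y ∈ stage Str c k s, cyl y) < 2},
        ⋃ y ∈ stage Str c k s, cyl y := by
    ext ω
    simp only [trimmed, Set.mem_iUnion, Set.mem_ofPred_eq, Subtype.exists, exists_prop]
    constructor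
    · rintro ⟨x, ⟨s, hs, hx⟩, hω⟩
      exact ⟨s, hs, x, hx, hω⟩
    · rintro ⟨s, hs, x, hx, hω⟩
      exact ⟨x, ⟨s, hs, hx⟩, hω⟩
  rw [h, Directed.measure_iUnion]
  · refine iSup_le fun s => ?_
    rw [ENNReal.inv_pow.symm, ← div_eq_mul_inv, ENNReal.le_div_iff_mul_le (by simp) (by simp),
      mul_comm]
    exact s.2.le
  · refine Monotone.directed_le fun s t hst => ?_
    exact Set.biUnion_subset_biUnion_left fun x hx => stage_mono hst hx

theorem rePred_trimmed [IsFiniteMeasure μ] (hμ : IsComputableMeasure μ) :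
    REPred fun p : (Code × ℕ) × Str => p.2 ∈ trimmed μ p.1.1 p.1.2 := by
  have h1 : REPred fun p : ((Code × ℕ) × Str) × (ℕ × (ℕ × ℕ)) =>
      μ (⋃ y ∈ stage Str p.1.1.1 p.1.1.2 p.2.1, cyl y) < rat p.2.2 :=
    REPred.comp (f := fun p : ((Code × ℕ) × Str) × (ℕ × (ℕ × ℕ)) =>
        (stage Str p.1.1.1 p.1.1.2 p.2.1, p.2.2)) hμ.rePred_biUnion_cyl_lt
      (Primrec.to_comp ((primrec_stage.comp ((Primrec.fst.comp Primrec.fst).pair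
        (Primrec.fst.comp Primrec.snd))).pair (Primrec.snd.comp Primrec.snd)))
  have h2 : PrimrecPred fun p : ((Code × ℕ) × Str) × (ℕ × (ℕ × ℕ)) =>
      rat (ratMul (2 ^ p.1.1.2, 0) p.2.2) < rat (2, 0) :=
    primrecRel_rat_lt.comp (primrec_ratMul.comp (primrec_rat_two_pow.comp
      (Primrec.snd.comp (Primrec.fst.comp Primrec.fst))) (Primrec.snd.comp Primrec.snd))
      (Primrec.const _)
  have h3 : PrimrecPred fun p : ((Code × ℕ) × Str) × (ℕ × (ℕ × ℕ)) =>
      ∃ y ∈ stage Str p.1.1.1 p.1.1.2 p.2.1, y = p.1.2 :=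
    (Primrec.eq (α := Str)).exists_mem_list.comp
      (primrec_stage.comp ((Primrec.fst.comp Primrec.fst).pair (Primrec.fst.comp Primrec.snd)))
      (Primrec.snd.comp Primrec.fst)
  refine (h1.and (h2.and h3).re).exists_snd.of_eq fun p => ?_
  have h4 : rat (2, 0) = 2 := by simp [rat]
  simp only [Prod.exists, trimmed, Set.mem_ofPred_eq, exists_eq_right, rat_ratMul, rat_two_pow, h4]
  refine exists_congr fun s => ?_
  constructor
  · rintro ⟨m, n, h1, h2, h3⟩
    refine ⟨lt_of_le_of_lt ?_ (ENNReal.coe_lt_coe.2 h2), h3⟩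
    push_cast
    gcongr
  · rintro ⟨h1, h3⟩
    rw [mul_comm, ← ENNReal.lt_div_iff_mul_lt (by simp) (by simp)] at h1
    obtain ⟨q, hq1, hq2⟩ := exists_rat_btwn h1
    refine ⟨q.1, q.2, hq1, ?_, h3⟩
    rw [ENNReal.lt_div_iff_mul_lt (by simp) (by simp), mul_comm] at hq2
    exact_mod_cast hq2

/-- The levels of a universal Martin-Löf test. -/
def testLevel (m : ℕ) : Set Str := {x | ∃ c : Code, x ∈ trimmed μ c (m + encode c + 3)}

theorem measure_testLevel_le (m : ℕ) :
    μ (⋃ x ∈ testLevel μ m, cyl x) ≤ (2⁻¹ : ℝ≥0∞) ^ (m + 1) := by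
  have h : ⋃ x ∈ testLevel μ m, cyl x =
      ⋃ c : Code, ⋃ x ∈ trimmed μ c (m + encode c + 3), cyl x := by
    ext ω
    simp only [testLevel, Set.mem_iUnion, Set.mem_ofPred_eq, exists_prop]
    constructor
    · rintro ⟨x, ⟨c, hx⟩, hω⟩
      exact ⟨c, x, hx, hω⟩
    · rintro ⟨c, x, hx, hω⟩
      exact ⟨x, ⟨c, hx⟩, hω⟩
  rw [h]
  calc μ (⋃ c : Code, ⋃ x ∈ trimmed μ c (m + encode c + 3), cyl x)
      ≤ ∑' c : Code, μ (⋃ x ∈ trimmed μ c (m + encode c + 3), cyl x) := measure_iUnion_le _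
    _ ≤ ∑' c : Code, (2⁻¹ : ℝ≥0∞) ^ (m + 1) * (2⁻¹ : ℝ≥0∞) ^ (encode c + 1) := by
        refine ENNReal.tsum_le_tsum fun c => (measure_trimmed_le μ c _).trans (le_of_eq ?_)
        have h2 : (2 : ℝ≥0∞) * 2⁻¹ = 1 := ENNReal.mul_inv_cancel (by simp) (by simp)
        -- The offset 3 absorbs the trimming factor 2, the extra 1 in `m + 1` and the extra 1 in the
        -- weight of `c`.
        calc (2 : ℝ≥0∞) * 2⁻¹ ^ (m + encode c + 3)
            = (2 * 2⁻¹) * (2⁻¹ ^ (m + 1) * 2⁻¹ ^ (encode c + 1)) := by ring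
          _ = _ := by rw [h2, one_mul]
    _ = (2⁻¹ : ℝ≥0∞) ^ (m + 1) * ∑' c : Code, (2⁻¹ : ℝ≥0∞) ^ (encode c + 1) :=
        ENNReal.tsum_mul_left
    _ ≤ (2⁻¹ : ℝ≥0∞) ^ (m + 1) * 1 := by gcongr; exact tsum_two_pow_code
    _ = _ := mul_one _

theorem rePred_testLevel [IsFiniteMeasure μ] (hμ : IsComputableMeasure μ) :
    REPred fun p : ℕ × Str => p.2 ∈ testLevel μ p.1 :=
  (REPred.comp (f := fun p : (ℕ × Str) × Code => ((p.2, p.1.1 + encode p.2 + 3), p.1.2))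
    (rePred_trimmed μ hμ) (Primrec.to_comp ((Primrec.snd.pair (Primrec.nat_add.comp
      (Primrec.nat_add.comp (Primrec.fst.comp Primrec.fst) (Primrec.encode.comp Primrec.snd))
      (Primrec.const 3))).pair (Primrec.snd.comp Primrec.fst)))).exists_snd.of_eq fun _ => Iff.rfl

/-- A universal probability bounded test, with the lower bound `1 / (N + 1)`. -/
def universalTest (N : ℕ) (ω : Cantor) : ℝ≥0∞ :=
  max (rat (1, N)) (⨆ m : ℕ, ⨆ _ : ω ∈ ⋃ x ∈ testLevel μ m, cyl x, (2 : ℝ≥0∞) ^ m)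

theorem lt_universalTest_iff (N : ℕ) (ω : Cantor) (r : ℝ≥0∞) :
    r < universalTest μ N ω ↔ r < rat (1, N) ∨
      ∃ m : ℕ, ω ∈ ⋃ x ∈ testLevel μ m, cyl x ∧ r < 2 ^ m := by
  simp only [universalTest, lt_max_iff, lt_iSup_iff, exists_prop]

theorem lowerSemicomputable_universalTest [IsFiniteMeasure μ] (hμ : IsComputableMeasure μ)
    (N : ℕ) : LowerSemicomputable (universalTest μ N) := by
  refine ⟨fun p => rat p.1 < rat (1, N) ∨ ∃ m : ℕ, p.2 ∈ testLevel μ m ∧ rat p.1 < rat (2 ^ m, 0),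
    ?_, fun r => ?_⟩
  · have h1 : PrimrecPred fun p : (ℕ × ℕ) × Str => rat p.1 < rat (1, N) :=
      primrecRel_rat_lt.comp Primrec.fst (Primrec.const _)
    have h2 : REPred fun p : ((ℕ × ℕ) × Str) × ℕ => p.1.2 ∈ testLevel μ p.2 :=
      REPred.comp (f := fun p : ((ℕ × ℕ) × Str) × ℕ => (p.2, p.1.2)) (rePred_testLevel μ hμ)
        (Computable.snd.pair (Computable.snd.comp Computable.fst))
    have h3 : PrimrecPred fun p : ((ℕ × ℕ) × Str) × ℕ => rat p.1.1 < rat (2 ^ p.2, 0) :=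
      primrecRel_rat_lt.comp (Primrec.fst.comp Primrec.fst)
        (primrec_rat_two_pow.comp Primrec.snd)
    exact h1.re.or (h2.and h3.re).exists_snd
  · ext ω
    simp only [Set.mem_ofPred_eq, Set.mem_iUnion, exists_prop, lt_universalTest_iff, rat_two_pow,
      ENNReal.coe_lt_coe]
    constructor
    · rintro (h | ⟨m, ⟨x, hx, hω⟩, hm⟩)
      · exact ⟨_, Or.inl h, mem_cyl_initSeg ω 0⟩
      · exact ⟨x, Or.inr ⟨m, hx, by exact_mod_cast hm⟩, hω⟩
    · rintro ⟨x, h | ⟨m, hx, hm⟩, hω⟩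
      · exact Or.inl h
      · exact Or.inr ⟨m, ⟨x, hx, hω⟩, by exact_mod_cast hm⟩

/-- Below the floor `1 / (N + 1)` the total mass suffices. Otherwise only levels from the least `m`
with `r < 2 ^ m` onwards contribute; they need not be nested, so their measures are summed, to at
most `2^{-m}`. -/
theorem measure_lt_universalTest_le {N : ℕ} (hN : μ Set.univ ≤ N) (r : ℝ≥0∞) (hr : r ≠ ∞) :
    μ {ω | r < universalTest μ N ω} ≤ 1 / r := by
  by_cases h : r < rat (1, N)
  · calc μ {ω | r < universalTest μ N ω} ≤ μ Set.univ := measure_mono (Set.subset_univ _)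
      _ ≤ N := hN
      _ ≤ N + 1 := le_self_add
      _ = 1 / (rat (1, N) : ℝ≥0∞) := by
          rw [rat, ENNReal.coe_div (by positivity)]
          push_cast
          rw [one_div, one_div, inv_inv]
      _ ≤ 1 / r := ENNReal.div_le_div_left h.le 1
  · have hex : ∃ m : ℕ, r < 2 ^ m := by
      obtain ⟨n, hn⟩ := ENNReal.exists_nat_gt hr
      exact ⟨n, hn.trans (by exact_mod_cast Nat.lt_two_pow_self)⟩
    classical
    have hsub : {ω | r < universalTest μ N ω} ⊆
        ⋃ j : ℕ, ⋃ x ∈ testLevel μ (Nat.find hex + j), cyl x := by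
      intro ω hω
      obtain hω | ⟨m, hm, hrm⟩ := (lt_universalTest_iff μ N ω r).1 hω
      · exact absurd hω h
      · refine Set.mem_iUnion.2 ⟨m - Nat.find hex, ?_⟩
        rwa [Nat.add_sub_cancel' (Nat.find_min' hex hrm)]
    calc μ {ω | r < universalTest μ N ω}
        ≤ ∑' j : ℕ, μ (⋃ x ∈ testLevel μ (Nat.find hex + j), cyl x) :=
          (measure_mono hsub).trans (measure_iUnion_le _)
      _ ≤ ∑' j : ℕ, (2⁻¹ : ℝ≥0∞) ^ Nat.find hex * (2⁻¹ : ℝ≥0∞) ^ (j + 1) := by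
          refine ENNReal.tsum_le_tsum fun j => (measure_testLevel_le μ _).trans (le_of_eq ?_)
          rw [← pow_add, add_assoc]
      _ = (2⁻¹ : ℝ≥0∞) ^ Nat.find hex := by
          rw [ENNReal.tsum_mul_left, ENNReal.tsum_geometric_add_one, ENNReal.one_sub_inv_two,
            ENNReal.mul_inv_cancel (by simp) (by simp), mul_one]
      _ ≤ 1 / r := by
          rw [← ENNReal.inv_pow, one_div]
          exact ENNReal.inv_le_inv.2 (Nat.find_spec hex).le

theorem exists_isMaxProbBounded [IsFiniteMeasure μ] (hμ : IsComputableMeasure μ) :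
    ∃ t, IsMaxProbBounded μ t := by
  obtain ⟨N, hN⟩ := ENNReal.exists_nat_gt (measure_ne_top μ Set.univ)
  refine ⟨universalTest μ N, ⟨lowerSemicomputable_universalTest μ hμ N,
    fun c _ => measure_lt_universalTest_le μ hN.le _ ENNReal.coe_ne_top⟩, ?_⟩
  rintro t ⟨W, hW, ht⟩ hb
  have hW' : REPred fun p : ℕ × Str => W ((2 ^ p.1, 0), p.2) :=
    REPred.comp (f := fun p : ℕ × Str => (((2 ^ p.1, 0) : ℕ × ℕ), p.2)) hW
      (Primrec.to_comp ((primrec_rat_two_pow.comp Primrec.fst).pair Primrec.snd))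
  obtain ⟨c, hc⟩ := hW'.exists_stage
  have hpow : ∀ k : ℕ, ((rat (2 ^ k, 0) : ℝ≥0) : ℝ≥0∞) = 2 ^ k := fun k => by
    rw [rat_two_pow]; push_cast; rfl
  have hlevel : ∀ (m : ℕ) (ω : Cantor), 2 ^ (m + encode c + 3) < t ω →
      2 ^ m ≤ universalTest μ N ω := by
    intro m ω hω
    have hset := ht (2 ^ (m + encode c + 3), 0)
    have hμt := hb (2 ^ (m + encode c + 3), 0) (by rw [rat_two_pow]; positivity)
    rw [hpow] at hset hμt
    have hmem : ω ∈ ⋃ x ∈ {x : Str | W ((2 ^ (m + encode c + 3), 0), x)}, cyl x := by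
      rw [← hset]; exact hω
    simp only [Set.mem_iUnion, Set.mem_ofPred_eq, exists_prop] at hmem
    obtain ⟨x, hx, hωx⟩ := hmem
    obtain ⟨s, hs⟩ := (hc _ x).1 hx
    have hx' : x ∈ testLevel μ m := by
      refine ⟨c, s, ?_, hs⟩
      have hle : μ (⋃ y ∈ stage Str c (m + encode c + 3) s, cyl y) ≤
          1 / 2 ^ (m + encode c + 3) := by
        refine (measure_mono ?_).trans hμt
        rw [hset]
        exact Set.biUnion_subset_biUnion_left fun y hy => (hc _ y).2 ⟨s, hy⟩
      -- Probability boundedness gives at most 1 where trimming allows anything below 2, so this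
      -- stage survives.
      rw [ENNReal.le_div_iff_mul_le (by simp) (by simp), mul_comm] at hle
      exact hle.trans_lt ENNReal.one_lt_two
    refine le_max_of_le_right ?_
    exact le_iSup₂_of_le m (Set.mem_biUnion hx' hωx) le_rfl
  refine ⟨2 ^ (encode c + 4) * (N + 1), fun ω => ?_⟩
  push_cast
  by_contra! hlt
  -- The floor makes the rescaled test at least 1, so that it lies within a factor 2 of some `2 ^ m`
  -- with `m` a natural number.
  have hone : 1 ≤ ((N : ℝ≥0∞) + 1) * universalTest μ N ω := by
    have h1 : (rat (1, N) : ℝ≥0∞) ≤ universalTest μ N ω := le_max_left _ _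
    have h2 : ((N : ℝ≥0∞) + 1) * (rat (1, N) : ℝ≥0∞) = 1 := by
      rw [rat, ENNReal.coe_div (by positivity)]
      push_cast
      rw [one_div]
      exact ENNReal.mul_inv_cancel (by simp) (by simp)
    exact h2.symm.le.trans (mul_le_mul_right h1 _)
  have hT : universalTest μ N ω ≠ ∞ := by
    intro h
    rw [h, ENNReal.mul_top (by positivity)] at hlt
    exact not_top_lt hlt
  have hex : ∃ m : ℕ, ((N : ℝ≥0∞) + 1) * universalTest μ N ω < 2 ^ m := by
    obtain ⟨n, hn⟩ := ENNReal.exists_nat_gt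
      (ENNReal.mul_ne_top (by simp : ((N : ℝ≥0∞) + 1) ≠ ∞) hT)
    exact ⟨n, hn.trans (by exact_mod_cast Nat.lt_two_pow_self)⟩
  classical
  have hfind : (2 : ℝ≥0∞) ^ Nat.find hex ≤ 2 * (((N : ℝ≥0∞) + 1) * universalTest μ N ω) := by
    rcases h : Nat.find hex with _ | k
    · rw [pow_zero]
      exact hone.trans (le_mul_of_one_le_left' ENNReal.one_lt_two.le)
    · have := not_lt.1 (Nat.find_min hex (m := k) (by omega))
      rw [pow_succ, mul_comm]
      gcongr
  have h1 : (2 : ℝ≥0∞) ^ (Nat.find hex + encode c + 3) < t ω := by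
    refine lt_of_le_of_lt ?_ hlt
    calc (2 : ℝ≥0∞) ^ (Nat.find hex + encode c + 3)
        = 2 ^ (encode c + 3) * 2 ^ Nat.find hex := by ring
      _ ≤ 2 ^ (encode c + 3) * (2 * (((N : ℝ≥0∞) + 1) * universalTest μ N ω)) := by gcongr
      _ = 2 ^ (encode c + 4) * (N + 1) * universalTest μ N ω := by ring
  -- Membership in this level forces the test to be at least `2 ^ m`, above `N + 1` times itself.
  have h2 := (Nat.find_spec hex).trans_le (hlevel _ ω h1)
  refine absurd h2 (not_lt.2 ?_)
  exact le_mul_of_one_le_left' (by simp)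

end UniversalTest

/-! ### Comparison of the two deficiencies -/

section Deficiency

theorem log2_mono {x y : ℝ≥0∞} (h : x ≤ y) : log2 x ≤ log2 y :=
  EReal.div_le_div_right_of_nonneg (by exact_mod_cast (Real.log_pos one_lt_two).le)
    (ENNReal.log_monotone h)

theorem log2_mul (x y : ℝ≥0∞) : log2 (x * y) = log2 x + log2 y := by
  rw [log2, ENNReal.log_mul_add, EReal.add_div_of_nonneg_right]
  · rfl
  · exact_mod_cast (Real.log_pos one_lt_two).le

theorem log2_inv (x : ℝ≥0∞) : log2 x⁻¹ = - log2 x := by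
  rw [log2, ENNReal.log_inv, div_eq_mul_inv, EReal.neg_mul, log2, div_eq_mul_inv]

theorem exists_log2_eq {C : ℝ≥0} (hC : C ≠ 0) : ∃ c : ℝ, log2 C = c :=
  ⟨Real.log C / Real.log 2, by rw [log2, ENNReal.log_of_nnreal hC, ← EReal.coe_div]⟩

variable (μ : Measure Cantor) (a : Str → ℝ≥0)

/-- The supremum of the ratios of `a` and `μ` along the initial segments of a sequence. -/
def maxRatio (ω : Cantor) : ℝ≥0∞ := ⨆ n, (a (initSeg ω n) : ℝ≥0∞) / μ (cyl (initSeg ω n))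

/-- The conventions agree at degenerate values: if `a` and `μ` both vanish, then `⊤ - ⊤ = ⊥` on one
side and `log2 (0 / 0) = log2 0 = ⊥` on the other. -/
theorem dA_le_log2_maxRatio (ω : Cantor) : dA μ a ω ≤ log2 (maxRatio μ a ω) := by
  refine iSup_le fun n => ?_
  rw [KA, sub_eq_add_neg, neg_neg, ← log2_inv, ← log2_mul, mul_comm, ← div_eq_mul_inv]
  exact log2_mono (le_iSup (fun n => (a (initSeg ω n) : ℝ≥0∞) / μ (cyl (initSeg ω n))) n)

theorem setOf_lt_maxRatio (r : ℝ≥0∞) :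
    {ω | r < maxRatio μ a ω} = ⋃ x ∈ {x : Str | r < a x / μ (cyl x)}, cyl x := by
  ext ω
  simp only [maxRatio, lt_iSup_iff, Set.mem_ofPred_eq, Set.mem_iUnion, exists_prop]
  constructor
  · rintro ⟨n, hn⟩
    exact ⟨_, hn, mem_cyl_initSeg ω n⟩
  · rintro ⟨x, hx, hω⟩
    refine ⟨x.length, ?_⟩
    rwa [show initSeg ω x.length = x from hω]

variable {μ a}

/-- The case `m = 0` is included because `0 / 0 = 0` and `b / 0 = ∞` for `b ≠ 0`. -/
theorem coe_lt_div_iff {r b : ℝ≥0} {m : ℝ≥0∞} (hm' : m ≠ ∞) :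
    (r : ℝ≥0∞) < b / m ↔ r * m < b := by
  rcases eq_or_ne m 0 with rfl | hm
  · rcases eq_or_ne b 0 with rfl | hb
    · simp
    · rw [ENNReal.div_zero (by simpa using hb)]
      simp [pos_iff_ne_zero, hb]
  · exact ENNReal.lt_div_iff_mul_lt (Or.inl hm) (Or.inl hm')

/-- The inequality `r μ[x] < a(x)` is witnessed by a rational `q > μ[x]` with `r q < a(x)`, and both
conditions are enumerable. -/
theorem rePred_lt_ratio [IsFiniteMeasure μ] (hμ : IsComputableMeasure μ)
    (ha : LowerSemicomputableStr a) :
    REPred fun p : (ℕ × ℕ) × Str => (rat p.1 : ℝ≥0∞) < a p.2 / μ (cyl p.2) := by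
  have h1 : REPred fun p : ((ℕ × ℕ) × Str) × (ℕ × ℕ) => μ (cyl p.1.2) < rat p.2 :=
    REPred.comp (f := fun p : ((ℕ × ℕ) × Str) × (ℕ × ℕ) => (p.1.2, p.2)) hμ.rePred_cyl_lt
      ((Computable.snd.comp Computable.fst).pair Computable.snd)
  have h2 : REPred fun p : ((ℕ × ℕ) × Str) × (ℕ × ℕ) => rat (ratMul p.1.1 p.2) < a p.1.2 :=
    REPred.comp (f := fun p : ((ℕ × ℕ) × Str) × (ℕ × ℕ) => (ratMul p.1.1 p.2, p.1.2)) ha.rePred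
      (Primrec.to_comp ((primrec_ratMul.comp (Primrec.fst.comp Primrec.fst) Primrec.snd).pair
        (Primrec.snd.comp Primrec.fst)))
  refine (h1.and h2).exists_snd.of_eq fun p => ?_
  rw [coe_lt_div_iff (measure_ne_top _ _)]
  simp only [rat_ratMul, ← ENNReal.coe_lt_coe, ENNReal.coe_mul]
  constructor
  · rintro ⟨q, hq1, hq2⟩
    exact lt_of_le_of_lt (by gcongr) hq2
  · intro h
    have hlt : μ (cyl p.2) < a p.2 / (rat p.1 : ℝ≥0∞) := by
      rw [← ENNReal.coe_toNNReal (measure_ne_top μ (cyl p.2))] at h ⊢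
      rwa [coe_lt_div_iff ENNReal.coe_ne_top, mul_comm]
    obtain ⟨q, hq1, hq2⟩ := exists_rat_btwn hlt
    rw [coe_lt_div_iff ENNReal.coe_ne_top, mul_comm] at hq2
    exact ⟨q, hq1, hq2⟩

/-- Each minimal string satisfies `c μ[x] < a(x)`; summing over the prefix-free set of them bounds
the measure, as in Ville's inequality. -/
theorem probBounded_maxRatio [IsFiniteMeasure μ]
    (ha : ∀ S : Set Str, PrefixFree S → ∑' x : S, (a (x : Str) : ℝ≥0∞) ≤ 1) :
    ProbBounded μ (maxRatio μ a) := by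
  intro c hc
  rw [setOf_lt_maxRatio, measure_biUnion_cyl,
    ENNReal.le_div_iff_mul_le (Or.inr one_ne_zero) (Or.inr ENNReal.one_ne_top),
    ← ENNReal.tsum_mul_right]
  refine (ENNReal.tsum_le_tsum fun x => ?_).trans (ha _ (prefixFree_minimalStrings _))
  rw [mul_comm]
  exact ((coe_lt_div_iff (measure_ne_top _ _)).1 x.2.1).le

theorem exists_dA_le_dP [IsFiniteMeasure μ] (hμ : IsComputableMeasure μ) {t : Cantor → ℝ≥0∞}
    (ha : IsContSemimeasure a) (ht : IsMaxProbBounded μ t) :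
    ∃ c : ℝ, ∀ ω, dA μ a ω ≤ dP t ω + (c : EReal) := by
  obtain ⟨C, hC⟩ := ht.2 (maxRatio μ a)
    ⟨_, rePred_lt_ratio hμ ha.1, fun r => setOf_lt_maxRatio μ a _⟩ (probBounded_maxRatio ha.2)
  -- `C` may be 0, with logarithm `⊥`; `C + 1` has a real logarithm.
  obtain ⟨c, hc⟩ := exists_log2_eq (C := C + 1) (by positivity)
  refine ⟨c, fun ω => (dA_le_log2_maxRatio μ a ω).trans ?_⟩
  rw [← hc, dP, add_comm, ← log2_mul]
  refine log2_mono ((hC ω).trans ?_)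
  gcongr
  exact le_self_add

end Deficiency

end RandDef

end

theorem mainTheorem7 (μ : MeasureTheory.Measure RandDef.Cantor)
    [MeasureTheory.IsFiniteMeasure μ] (hμ : RandDef.IsComputableMeasure μ) :
    (∃ a : RandDef.Str → NNReal, RandDef.IsAPriori a) ∧
    (∃ t : RandDef.Cantor → ENNReal, RandDef.IsMaxProbBounded μ t) ∧
    ∀ (a : RandDef.Str → NNReal) (t : RandDef.Cantor → ENNReal),
      RandDef.IsAPriori a → RandDef.IsMaxProbBounded μ t →
        ∃ c : ℝ, ∀ ω : RandDef.Cantor, RandDef.dA μ a ω ≤ RandDef.dP t ω + (c : EReal) :=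
  ⟨RandDef.exists_isAPriori, RandDef.exists_isMaxProbBounded μ hμ,
    fun _ _ ha ht => RandDef.exists_dA_le_dP hμ ha.1 ht⟩
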